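/- Let $G$ be a connected, locally finite simple graph, and let $G_1\subseteq G_2\subseteq\cdots$ be finite subgraphs of $G$ whose union is $G$. For a finite graph $F$ let $H(F)$ be its Hashimoto matrix: it is indexed by the arcs (directed edges) of $F$, with $H(F)_{a,b}=1$ if the head of $a$ is the tail of $b$ and $b$ is not the reverse of $a$, and $H(F)_{a,b}=0$ otherwise; let $\rho(H(F))$ be its spectral radius (taken to be $0$ if $F$ has no edges). In site percolation on $G$ with parameter $p\in[0,1]$ each vertex is open with probability $p$, independently of the others, and the clusters are the connected components of the subgraph induced by the open vertices. Let $p_u$ be the infimum of all $p\in[0,1]$ such that almost surely there is exactly one infinite cluster ($p_u=\infty$ if there is no such $p$, as for a finite graph). Then the limit $\rho_0=\lim_{t\to\infty}\rho(H(G_t))\in[0,\infty]$ exists, and $$p_u\ \ge\ \frac1{\rho_0}$$ if $\rho_0\neq 0$ (with $1/\infty=0$), while $p_u\ge 1$ if $\rho_0=0$. -/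

import Mathlib

open Filter Topology MeasureTheory
open scoped ENNReal

namespace SitePercolation

universe u

variable {V : Type u}

open Classical in
/-- The Hashimoto (non-backtracking) matrix of a graph, indexed by its arcs (darts): the entry at
`(a, b)` is `1` if the head of `a` is the tail of `b` and `b` is not the reverse of `a`, and it
is `0` otherwise. -/
noncomputable def hashimoto (G : SimpleGraph V) : Matrix G.Dart G.Dart ℂ :=
  Matrix.of fun a b => if a.snd = b.fst ∧ b ≠ a.symm then 1 else 0

/-- A finite graph has finitely many arcs. -/
instance finite_dart (G : SimpleGraph V) [Finite V] : Finite G.Dart :=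
  Finite.of_injective _ (SimpleGraph.Dart.toProd_injective (G := G))

open Classical in
/-- The spectral radius (largest modulus of a complex eigenvalue) of the Hashimoto matrix of a
finite graph. It is `0` for a graph without edges. -/
noncomputable def hashimotoRadius (G : SimpleGraph V) [Finite V] : ℝ≥0∞ :=
  letI : Fintype G.Dart := Fintype.ofFinite G.Dart
  spectralRadius ℂ (hashimoto G)

/-- For the set `ω` of open vertices: the subgraph induced by the open vertices has exactly one
infinite connected component. -/
def HasUniqueInfiniteCluster (G : SimpleGraph V) (ω : Set V) : Prop :=
  ∃! C : (G.induce ω).ConnectedComponent, C.supp.Infinite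

/-- The uniqueness transition of site percolation: the infimum of the `p ∈ [0, 1]` for which there
is almost surely exactly one infinite open cluster, every vertex being open with probability `p`
independently of the others (`∞` if there is no such `p`, as on a finite graph). -/
noncomputable def uniquenessTransition (G : SimpleGraph V) : ℝ≥0∞ :=
  ⨅ (p : unitInterval)
    (_ : ∀ᵐ ω ∂(ProbabilityTheory.setBernoulli (Set.univ : Set V) p),
      HasUniqueInfiniteCluster G ω),
    ENNReal.ofReal (p : ℝ)

end SitePercolation

/-!
Give the vertices independent uniform labels and open, at level `p`, those with label at most `p`.
Let `p < q` with `q ρ₀ < 1`, and suppose that at level `p` the infinite cluster is unique.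

A closed non-backtracking walk is a closed path of the Hashimoto matrix, so `c` lies on at most
`deg(c) ρ₀ ^ n` cycles of length `n`. Hence by Borel–Cantelli only finitely many cycles through `c`
are open at level `q`.

On the other hand, uniqueness at level `p` survives the closing of finitely many vertices. Call `v`
a cut site of `x` if closing `v` separates `x`, even at level `q`, from the infinite cluster of
level `p`. Being a cut site of `x` is, up to the label of `v`, an event that can hold for only one
vertex with label in `(p, q]`, so the probabilities of these events are summable and there are
finitely many cut sites. Moving from `x` to a cut site of `x` decreases the set of cut sites, so
some vertex `c` of the infinite cluster has none. By Menger's theorem two paths then lead from `c`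
to the infinite cluster that remains after closing any given finite set, and they close up there to
an open cycle. So infinitely many cycles through `c` are open at level `q`, a contradiction.
-/

namespace SitePercolation

open Function Set SimpleGraph
open scoped NNReal

variable {V : Type*}

theorem spectralRadius_eq_zero_of_isNilpotent {𝕜 R : Type*} [NormedField 𝕜] [Ring R] [Algebra 𝕜 R]
    {a : R} (ha : IsNilpotent a) : spectralRadius 𝕜 a = 0 := by
  obtain ⟨n, hn⟩ := ha
  cases subsingleton_or_nontrivial R
  · exact spectrum.SpectralRadius.of_subsingleton a
  · refine iSup₂_eq_bot.mpr fun k hk => ?_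
    have hkn : k ^ n ∈ spectrum 𝕜 (0 : R) := hn ▸ spectrum.pow_mem_pow a n hk
    rw [spectrum.zero_eq, Set.mem_singleton_iff] at hkn
    simp [eq_zero_of_pow_eq_zero hkn]

section NonnegMatrix

variable {ι κ : Type*} [Fintype ι] [Fintype κ]

/-- The largest row sum of a nonnegative matrix, that is, its operator norm on `ℓ^∞`. -/
noncomputable def maxRowSum (A : Matrix ι ι ℝ≥0) : ℝ≥0 :=
  Finset.univ.sup fun i => ∑ j, A i j

theorem apply_le_maxRowSum (A : Matrix ι ι ℝ≥0) (i j : ι) : A i j ≤ maxRowSum A :=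
  (Finset.single_le_sum_of_canonicallyOrdered (Finset.mem_univ j)).trans
    (Finset.le_sup (f := fun i => ∑ j, A i j) (Finset.mem_univ i))

theorem sum_apply_le_sum_apply {A : Matrix ι ι ℝ≥0} {B : Matrix κ κ ℝ≥0} {f : ι → κ}
    (hf : Function.Injective f) {i : ι} (h : ∀ j, A i j ≤ B (f i) (f j)) :
    ∑ j, A i j ≤ ∑ k, B (f i) k :=
  calc ∑ j, A i j ≤ ∑ j, B (f i) (f j) := Finset.sum_le_sum fun j _ => h j
    _ = ∑ k ∈ Finset.univ.map ⟨f, hf⟩, B (f i) k := by simp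
    _ ≤ ∑ k, B (f i) k := Finset.sum_le_sum_of_subset (Finset.subset_univ _)

theorem maxRowSum_le_maxRowSum {A : Matrix ι ι ℝ≥0} {B : Matrix κ κ ℝ≥0} {f : ι → κ}
    (hf : Function.Injective f) (h : ∀ i j, A i j ≤ B (f i) (f j)) :
    maxRowSum A ≤ maxRowSum B :=
  Finset.sup_le fun i _ => (sum_apply_le_sum_apply hf (h i)).trans
    (Finset.le_sup (f := fun k => ∑ l, B k l) (Finset.mem_univ (f i)))

variable [DecidableEq ι] [DecidableEq κ]

theorem tendsto_maxRowSum_pow_rpow (A : Matrix ι ι ℝ≥0) :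
    Tendsto (fun n : ℕ => (maxRowSum (A ^ n) : ℝ≥0∞) ^ (1 / n : ℝ)) atTop
      (𝓝 (spectralRadius ℂ (A.map (algebraMap ℝ≥0 ℂ)))) := by
  let _ : NormedRing (Matrix ι ι ℂ) := Matrix.linftyOpNormedRing
  let _ : NormedAlgebra ℂ (Matrix ι ι ℂ) := Matrix.linftyOpNormedAlgebra
  refine (spectrum.pow_nnnorm_pow_one_div_tendsto_nhds_spectralRadius
    (A.map (algebraMap ℝ≥0 ℂ))).congr fun n => ?_
  have hpow : A.map (algebraMap ℝ≥0 ℂ) ^ n = (A ^ n).map (algebraMap ℝ≥0 ℂ) :=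
    (map_pow (algebraMap ℝ≥0 ℂ).mapMatrix A n).symm
  have hnorm : ‖(A ^ n).map (algebraMap ℝ≥0 ℂ)‖₊ = maxRowSum (A ^ n) := by
    simp only [Matrix.linfty_opNNNorm_def, Matrix.map_apply, nnnorm_algebraMap_nnreal, maxRowSum]
  rw [hpow, hnorm]

theorem pow_apply_le_pow_apply {A : Matrix ι ι ℝ≥0} {B : Matrix κ κ ℝ≥0} {f : ι → κ}
    (hf : Function.Injective f) (h : ∀ i j, A i j ≤ B (f i) (f j)) (n : ℕ) (i j : ι) :
    (A ^ n) i j ≤ (B ^ n) (f i) (f j) := by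
  induction n generalizing i with
  | zero => simp [Matrix.one_apply, hf.eq_iff]
  | succ n ih =>
    simp only [pow_succ', Matrix.mul_apply]
    calc ∑ k, A i k * (A ^ n) k j ≤ ∑ k, B (f i) (f k) * (B ^ n) (f k) (f j) :=
          Finset.sum_le_sum fun k _ => mul_le_mul' (h i k) (ih k)
      _ = ∑ k ∈ Finset.univ.map ⟨f, hf⟩, B (f i) k * (B ^ n) k (f j) := by simp
      _ ≤ _ := Finset.sum_le_sum_of_subset (Finset.subset_univ _)

theorem spectralRadius_le_spectralRadius {A : Matrix ι ι ℝ≥0} {B : Matrix κ κ ℝ≥0} {f : ι → κ}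
    (hf : Function.Injective f) (h : ∀ i j, A i j ≤ B (f i) (f j)) :
    spectralRadius ℂ (A.map (algebraMap ℝ≥0 ℂ)) ≤
      spectralRadius ℂ (B.map (algebraMap ℝ≥0 ℂ)) := by
  refine le_of_tendsto_of_tendsto' (tendsto_maxRowSum_pow_rpow A)
    (tendsto_maxRowSum_pow_rpow B) fun n => ?_
  gcongr
  exact maxRowSum_le_maxRowSum hf (pow_apply_le_pow_apply hf h n)

theorem diag_pow_le_pow_diag (A : Matrix ι ι ℝ≥0) (i : ι) (n : ℕ) :
    A i i ^ n ≤ (A ^ n) i i := by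
  induction n with
  | zero => simp
  | succ n ih =>
    rw [pow_succ, pow_succ, Matrix.mul_apply]
    calc A i i ^ n * A i i ≤ (A ^ n) i i * A i i := by gcongr
      _ ≤ ∑ j, (A ^ n) i j * A j i :=
        Finset.single_le_sum_of_canonicallyOrdered (f := fun j => (A ^ n) i j * A j i)
          (Finset.mem_univ i)

theorem pow_diag_le_spectralRadius_pow (A : Matrix ι ι ℝ≥0) (i : ι) {n : ℕ} (hn : n ≠ 0) :
    ((A ^ n) i i : ℝ≥0∞) ≤ spectralRadius ℂ (A.map (algebraMap ℝ≥0 ℂ)) ^ n := by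
  have hmultiples : Tendsto (fun k : ℕ => n * (k + 1)) atTop atTop :=
    (tendsto_add_atTop_nat 1).const_mul_atTop' (Nat.pos_of_ne_zero hn)
  have hroot : ((A ^ n) i i : ℝ≥0∞) ^ (1 / n : ℝ) ≤
      spectralRadius ℂ (A.map (algebraMap ℝ≥0 ℂ)) := by
    refine ge_of_tendsto' ((tendsto_maxRowSum_pow_rpow A).comp hmultiples) fun k => ?_
    have hpow : (A ^ n) i i ^ (k + 1) ≤ maxRowSum (A ^ (n * (k + 1))) := by
      rw [pow_mul]
      exact (diag_pow_le_pow_diag (A ^ n) i (k + 1)).trans (apply_le_maxRowSum _ i i)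
    calc ((A ^ n) i i : ℝ≥0∞) ^ (1 / n : ℝ)
        = (((A ^ n) i i ^ (k + 1) : ℝ≥0) : ℝ≥0∞) ^ (1 / (n * (k + 1) : ℕ) : ℝ) := by
          rw [ENNReal.coe_pow, ← ENNReal.rpow_natCast, ← ENNReal.rpow_mul]
          congr 1
          push_cast
          field_simp
      _ ≤ (maxRowSum (A ^ (n * (k + 1))) : ℝ≥0∞) ^ (1 / (n * (k + 1) : ℕ) : ℝ) := by gcongr
  calc ((A ^ n) i i : ℝ≥0∞) = (((A ^ n) i i : ℝ≥0∞) ^ (1 / n : ℝ)) ^ n := by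
        rw [← ENNReal.rpow_natCast, ← ENNReal.rpow_mul,
          one_div_mul_cancel (Nat.cast_ne_zero.mpr hn), ENNReal.rpow_one]
    _ ≤ _ := pow_le_pow_left' hroot n

theorem pow_apply_eq_zero_or_one_le {A : Matrix ι ι ℝ≥0} (hA : ∀ i j, A i j = 0 ∨ 1 ≤ A i j)
    (n : ℕ) (i j : ι) : (A ^ n) i j = 0 ∨ 1 ≤ (A ^ n) i j := by
  induction n generalizing i with
  | zero => by_cases h : i = j <;> simp [h]
  | succ n ih =>
    rw [pow_succ', Matrix.mul_apply]
    by_cases h : ∀ k, A i k * (A ^ n) k j = 0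
    · exact .inl (Finset.sum_eq_zero fun k _ => h k)
    · obtain ⟨k, hk⟩ := not_forall.mp h
      right
      calc 1 ≤ A i k * (A ^ n) k j := one_le_mul ((hA i k).resolve_left (left_ne_zero_of_mul hk))
            ((ih k).resolve_left (right_ne_zero_of_mul hk))
        _ ≤ ∑ k, A i k * (A ^ n) k j :=
          Finset.single_le_sum_of_canonicallyOrdered (f := fun k => A i k * (A ^ n) k j)
            (Finset.mem_univ k)

theorem spectralRadius_eq_zero_or_one_le {A : Matrix ι ι ℝ≥0}
    (hA : ∀ i j, A i j = 0 ∨ 1 ≤ A i j) :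
    spectralRadius ℂ (A.map (algebraMap ℝ≥0 ℂ)) = 0 ∨
      1 ≤ spectralRadius ℂ (A.map (algebraMap ℝ≥0 ℂ)) := by
  by_cases hnil : ∃ n, A ^ n = 0
  · obtain ⟨n, hn⟩ := hnil
    left
    exact spectralRadius_eq_zero_of_isNilpotent
      (IsNilpotent.map ⟨n, hn⟩ (algebraMap ℝ≥0 ℂ).mapMatrix)
  · right
    refine ge_of_tendsto' (tendsto_maxRowSum_pow_rpow A) fun n => ?_
    obtain ⟨i, j, hij⟩ : ∃ i j, (A ^ n) i j ≠ 0 := by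
      by_contra! h
      exact hnil ⟨n, Matrix.ext h⟩
    have hone : (1 : ℝ≥0∞) ≤ maxRowSum (A ^ n) := by
      exact_mod_cast ((pow_apply_eq_zero_or_one_le hA n i j).resolve_left hij).trans
        (apply_le_maxRowSum _ i j)
    exact (ENNReal.one_rpow _).symm.trans_le (ENNReal.rpow_le_rpow hone (by positivity))

theorem card_le_pow_apply {A : Matrix ι ι ℝ≥0} {n : ℕ} {i j : ι} {L : Finset (List ι)}
    (hL : ∀ l ∈ L, l.length = n ∧ (i :: l).IsChain (fun a b => 1 ≤ A a b) ∧
      (i :: l).getLast (List.cons_ne_nil i l) = j) :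
    (L.card : ℝ≥0) ≤ (A ^ n) i j := by
  classical
  induction n generalizing i L with
  | zero =>
    have hnil : ∀ l ∈ L, l = [] := fun l hl => List.length_eq_zero_iff.mp (hL l hl).1
    rcases L.eq_empty_or_nonempty with rfl | ⟨l, hl⟩
    · simp
    · obtain rfl := hnil l hl
      have hij : i = j := (hL [] hl).2.2
      have hcard : L.card ≤ 1 := Finset.card_le_one.mpr fun a ha b hb =>
        (hnil a ha).trans (hnil b hb).symm
      simpa [hij] using hcard
  | succ n ih =>
    let tails (k : ι) : Finset (List ι) := L.preimage (List.cons k) List.cons_injective.injOn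
    have hcover : L ⊆ Finset.univ.biUnion fun k => (tails k).image (List.cons k) := by
      intro l hl
      obtain ⟨k, l, rfl⟩ := List.exists_cons_of_length_eq_add_one (hL l hl).1
      simpa [tails] using hl
    have htails (k : ι) : ((tails k).card : ℝ≥0) ≤ A i k * (A ^ n) k j := by
      have hk : ∀ l ∈ tails k, l.length = n ∧ 1 ≤ A i k ∧
          (k :: l).IsChain (fun a b => 1 ≤ A a b) ∧
          (k :: l).getLast (List.cons_ne_nil k l) = j := by
        intro l hl
        simpa [List.isChain_cons_cons, and_assoc] using hL (k :: l) (Finset.mem_preimage.mp hl)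
      rcases (tails k).eq_empty_or_nonempty with hempty | ⟨l, hl⟩
      · simp [hempty]
      · exact (ih fun l hl => ⟨(hk l hl).1, (hk l hl).2.2⟩).trans
          (le_mul_of_one_le_left' (hk l hl).2.1)
    calc (L.card : ℝ≥0) ≤ ∑ k, ((tails k).card : ℝ≥0) := by
          exact_mod_cast (Finset.card_le_card hcover).trans <| Finset.card_biUnion_le.trans <|
            Finset.sum_le_sum fun k _ => Finset.card_image_le
      _ ≤ ∑ k, A i k * (A ^ n) k j := Finset.sum_le_sum fun k _ => htails k
      _ = (A ^ (n + 1)) i j := by rw [pow_succ', Matrix.mul_apply]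

end NonnegMatrix

section Hashimoto

variable {W : Type*} {X : SimpleGraph V} {Y : SimpleGraph W}

open Classical in
/-- The Hashimoto matrix with entries in the nonnegative reals, the form in which its powers can be
compared entry by entry. -/
noncomputable def nnHashimoto (X : SimpleGraph V) : Matrix X.Dart X.Dart ℝ≥0 :=
  Matrix.of fun a b => if a.snd = b.fst ∧ b ≠ a.symm then 1 else 0

theorem nnHashimoto_map (X : SimpleGraph V) :
    (nnHashimoto X).map (algebraMap ℝ≥0 ℂ) = hashimoto X := by
  ext a b
  simp only [nnHashimoto, hashimoto, Matrix.map_apply, Matrix.of_apply]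
  split_ifs <;> simp only [map_one, map_zero]

theorem hashimotoRadius_eq (X : SimpleGraph V) [Finite V] [Fintype X.Dart] [DecidableEq X.Dart] :
    hashimotoRadius X = spectralRadius ℂ ((nnHashimoto X).map (algebraMap ℝ≥0 ℂ)) := by
  rw [nnHashimoto_map, hashimotoRadius]
  congr!

theorem one_le_nnHashimoto_iff {a b : X.Dart} :
    1 ≤ nnHashimoto X a b ↔ X.DartAdj a b ∧ b ≠ a.symm := by
  simp only [nnHashimoto, Matrix.of_apply, DartAdj]
  split_ifs with h
  · simp [h]
  · simpa using h

theorem mapDart_injective {f : X →g Y} (hf : Injective f) : Injective f.mapDart :=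
  fun _ _ hab => Dart.toProd_injective (hf.prodMap hf (congrArg Dart.toProd hab))

theorem nnHashimoto_mapDart {f : X →g Y} (hf : Injective f) (a b : X.Dart) :
    nnHashimoto Y (f.mapDart a) (f.mapDart b) = nnHashimoto X a b := by
  have hadj : (f.mapDart a).snd = (f.mapDart b).fst ↔ a.snd = b.fst := hf.eq_iff
  have hne : f.mapDart b ≠ (f.mapDart a).symm ↔ b ≠ a.symm :=
    (mapDart_injective hf).ne_iff (x := b) (y := a.symm)
  classical
  simp only [nnHashimoto, Matrix.of_apply]
  exact if_congr (and_congr hadj hne) rfl rfl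

theorem hashimotoRadius_le_of_injective [Finite V] [Finite W] {f : X →g Y} (hf : Injective f) :
    hashimotoRadius X ≤ hashimotoRadius Y := by
  classical
  have := Fintype.ofFinite X.Dart
  have := Fintype.ofFinite Y.Dart
  rw [hashimotoRadius_eq, hashimotoRadius_eq]
  exact spectralRadius_le_spectralRadius (mapDart_injective hf) fun a b =>
    (nnHashimoto_mapDart hf a b).ge

theorem hashimotoRadius_eq_zero_or_one_le (X : SimpleGraph V) [Finite V] :
    hashimotoRadius X = 0 ∨ 1 ≤ hashimotoRadius X := by
  classical
  have := Fintype.ofFinite X.Dart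
  rw [hashimotoRadius_eq]
  refine spectralRadius_eq_zero_or_one_le fun a b => ?_
  simp only [nnHashimoto, Matrix.of_apply]
  split_ifs
  · exact .inr le_rfl
  · exact .inl rfl

theorem isChain_ne_cons_append_singleton {α : Type*} {a : α} {l : List α} (h : (a :: l).Nodup)
    (hl : l ≠ []) : (a :: (l ++ [a])).IsChain (· ≠ ·) := by
  refine List.isChain_append (l₁ := a :: l).mpr ⟨List.Pairwise.isChain h, .singleton a, ?_⟩
  simp only [List.getLast?_cons_of_ne_nil hl, List.head?_cons, Option.mem_def, Option.some.injEq]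
  rintro x hx _ rfl rfl
  exact (List.nodup_cons.mp h).1 (List.mem_of_getLast? hx)

theorem isChain_one_le_nnHashimoto {c v : V} {h : X.Adj c v} {p : X.Walk v c}
    (hw : (Walk.cons h p).IsCycle) :
    (⟨(c, v), h⟩ :: (p.darts ++ [⟨(c, v), h⟩])).IsChain fun a b => 1 ≤ nnHashimoto X a b := by
  have hadj : (⟨(c, v), h⟩ :: (p.darts ++ [⟨(c, v), h⟩])).IsChain X.DartAdj := by
    simpa using ((Walk.cons h p).concat h).isChain_dartAdj_darts
  have hedge : (⟨(c, v), h⟩ :: (p.darts ++ [⟨(c, v), h⟩])).IsChain fun a b => a.edge ≠ b.edge := by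
    have hp : p.edges ≠ [] := fun hnil => by
      have := hw.three_le_length
      simp [← Walk.length_edges, hnil] at this
    refine (List.isChain_map (R := (· ≠ ·)) Dart.edge).mp ?_
    simpa [Walk.edges] using
      isChain_ne_cons_append_singleton (a := s(c, v)) (by simpa using hw.edges_nodup) hp
  rw [List.isChain_iff_getElem] at hadj hedge ⊢
  refine fun i hi => one_le_nnHashimoto_iff.mpr ⟨hadj i hi, fun hsymm => hedge i hi ?_⟩
  rw [hsymm, Dart.edge_symm]

theorem card_cycles_le_hashimotoRadius_pow [Finite V] {a : X.Dart} {n : ℕ}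
    {C : Finset (X.Walk a.fst a.fst)} (hC : ∀ w ∈ C, w.IsCycle ∧ w.length = n ∧ w.snd = a.snd) :
    (C.card : ℝ≥0∞) ≤ hashimotoRadius X ^ n := by
  classical
  have := Fintype.ofFinite X.Dart
  rcases C.eq_empty_or_nonempty with rfl | ⟨w₀, hw₀⟩
  · simp
  have hn : n ≠ 0 := by
    have := (hC w₀ hw₀).1.three_le_length
    have := (hC w₀ hw₀).2.1
    lia
  have hdarts : ∀ w ∈ C, w.darts = a :: w.darts.tail ∧
      (a :: (w.darts.tail ++ [a])).IsChain fun a b => 1 ≤ nnHashimoto X a b := by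
    intro w hw
    obtain ⟨hcycle, -, hsnd⟩ := hC w hw
    cases w with
    | nil => exact absurd hcycle Walk.not_isCycle_nil
    | cons h p =>
      rw [Walk.snd_cons] at hsnd
      subst hsnd
      exact ⟨rfl, isChain_one_le_nnHashimoto hcycle⟩
  have hinj : Set.InjOn (fun w : X.Walk a.fst a.fst => w.darts.tail ++ [a]) C := by
    intro w hw w' hw' htail
    apply Walk.darts_injective
    rw [(hdarts w hw).1, (hdarts w' hw').1, List.append_cancel_right htail]
  rw [hashimotoRadius_eq, ← Finset.card_image_of_injOn hinj]
  refine le_trans ?_ (pow_diag_le_spectralRadius_pow (nnHashimoto X) a hn)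
  have hcount := card_le_pow_apply (A := nnHashimoto X) (n := n) (i := a) (j := a)
    (L := C.image fun w => w.darts.tail ++ [a]) <| Finset.forall_mem_image.mpr fun w hw => by
      refine ⟨?_, (hdarts w hw).2, by simp⟩
      rw [← (hC w hw).2.1, ← Walk.length_darts, (hdarts w hw).1]
      simp
  exact_mod_cast hcount

theorem card_cycles_le_degree_mul_hashimotoRadius_pow [Finite V] {c : V}
    [Fintype (X.neighborSet c)] {n : ℕ} {C : Finset (X.Walk c c)}
    (hC : ∀ w ∈ C, w.IsCycle ∧ w.length = n) :
    (C.card : ℝ≥0∞) ≤ X.degree c * hashimotoRadius X ^ n := by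
  classical
  have hsnd : ∀ w ∈ C, w.snd ∈ X.neighborFinset c := fun w hw =>
    (X.mem_neighborFinset c _).mpr (w.adj_snd (hC w hw).1.not_nil)
  rw [Finset.card_eq_sum_card_fiberwise hsnd, ← X.card_neighborFinset_eq_degree, ← nsmul_eq_mul,
    Nat.cast_sum]
  refine Finset.sum_le_card_nsmul _ _ _ fun v hv => ?_
  have hcv : X.Adj c v := (X.mem_neighborFinset c v).mp hv
  refine card_cycles_le_hashimotoRadius_pow (a := ⟨(c, v), hcv⟩) fun w hw => ?_
  obtain ⟨hwC, hwv⟩ := Finset.mem_filter.mp hw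
  exact ⟨(hC w hwC).1, (hC w hwC).2, hwv⟩

end Hashimoto

section LimitRadius

variable {G : SimpleGraph V}

/-- The supremum of the Hashimoto spectral radii of the finite subgraphs of `G`, which is the limit
`ρ₀` along any exhaustion of `G`. -/
noncomputable def limitRadius (G : SimpleGraph V) : ℝ≥0∞ :=
  ⨆ (F : G.Subgraph) (_ : Finite F.verts), hashimotoRadius F.coe

theorem hashimotoRadius_coe_le_limitRadius (F : G.Subgraph) [hF : Finite F.verts] :
    hashimotoRadius F.coe ≤ limitRadius G :=
  le_iSup₂ (f := fun (F : G.Subgraph) (_ : Finite F.verts) => hashimotoRadius F.coe) F hF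

theorem hashimotoRadius_coe_mono {F F' : G.Subgraph} [Finite F.verts] [Finite F'.verts]
    (h : F ≤ F') : hashimotoRadius F.coe ≤ hashimotoRadius F'.coe :=
  hashimotoRadius_le_of_injective (Subgraph.inclusion.injective h)

theorem limitRadius_eq_zero_or_one_le (G : SimpleGraph V) :
    limitRadius G = 0 ∨ 1 ≤ limitRadius G := by
  by_cases h : ∃ (F : G.Subgraph) (_ : Finite F.verts), 1 ≤ hashimotoRadius F.coe
  · obtain ⟨F, hF, hone⟩ := h
    exact .inr (hone.trans (hashimotoRadius_coe_le_limitRadius F))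
  · push Not at h
    exact .inl (iSup₂_eq_bot.mpr fun F hF =>
      (hashimotoRadius_eq_zero_or_one_le F.coe).resolve_right (h F hF).not_ge)

theorem exists_subgraph_le_of_finite {ι : Type*} [Preorder ι] [IsDirectedOrder ι] [Nonempty ι]
    {S : ι → G.Subgraph} (hmono : Monotone S) (hlim : ⨆ t, S t = ⊤) (F : G.Subgraph)
    [Finite F.verts] : ∃ t, F ≤ S t := by
  have hverts (v : F.verts) : ∃ t, v.1 ∈ (S t).verts := by
    have : v.1 ∈ (⨆ t, S t).verts := hlim ▸ Set.mem_univ _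
    simpa using this
  have hdarts (d : F.coe.Dart) : ∃ t, (S t).Adj d.fst d.snd := by
    have : (⨆ t, S t).Adj d.fst d.snd := hlim ▸ F.adj_sub d.adj
    simpa using this
  choose s hs using hverts
  choose r hr using hdarts
  obtain ⟨t₁, ht₁⟩ := Finite.exists_le s
  obtain ⟨t₂, ht₂⟩ := Finite.exists_le r
  obtain ⟨t, h₁, h₂⟩ := exists_ge_ge t₁ t₂
  exact ⟨t, fun v hv => (hmono ((ht₁ ⟨v, hv⟩).trans h₁)).1 (hs ⟨v, hv⟩), fun v w hvw =>
    (hmono ((ht₂ ⟨(⟨v, F.edge_vert hvw⟩, ⟨w, F.edge_vert hvw.symm⟩), hvw⟩).trans h₂)).2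
      (hr ⟨(⟨v, F.edge_vert hvw⟩, ⟨w, F.edge_vert hvw.symm⟩), hvw⟩)⟩

theorem tendsto_hashimotoRadius {ι : Type*} [Preorder ι] [IsDirectedOrder ι] [Nonempty ι]
    {S : ι → G.Subgraph} [∀ t, Finite (S t).verts] (hmono : Monotone S) (hlim : ⨆ t, S t = ⊤) :
    Tendsto (fun t => hashimotoRadius (S t).coe) atTop (𝓝 (limitRadius G)) := by
  have hsup : ⨆ t, hashimotoRadius (S t).coe = limitRadius G := by
    refine le_antisymm (iSup_le fun t => hashimotoRadius_coe_le_limitRadius (S t))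
      (iSup₂_le fun F hF => ?_)
    obtain ⟨t, ht⟩ := exists_subgraph_le_of_finite hmono hlim F
    exact (hashimotoRadius_coe_mono ht).trans (le_iSup (fun t => hashimotoRadius (S t).coe) t)
  exact hsup ▸ tendsto_atTop_iSup fun _ _ h => hashimotoRadius_coe_mono (hmono h)

theorem exists_walk_map_hom_eq {F : G.Subgraph} {u v : V} {w : G.Walk u v} (hw : w.toSubgraph ≤ F)
    (hu : u ∈ F.verts) (hv : v ∈ F.verts) :
    ∃ w' : F.coe.Walk ⟨u, hu⟩ ⟨v, hv⟩, w'.map F.hom = w :=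
  ⟨w.mapToSubgraph.map (Subgraph.inclusion hw),
    (Walk.map_map _ _ _).trans w.map_mapToSubgraph_hom⟩

theorem card_cycles_le_degree_mul_limitRadius_pow {c : V} [Fintype (G.neighborSet c)] {n : ℕ}
    {C : Finset (G.Walk c c)} (hC : ∀ w ∈ C, w.IsCycle ∧ w.length = n) :
    (C.card : ℝ≥0∞) ≤ G.degree c * limitRadius G ^ n := by
  classical
  rcases C.eq_empty_or_nonempty with rfl | ⟨w₀, hw₀⟩
  · simp
  let F : G.Subgraph := ⨆ w ∈ C, w.toSubgraph
  have hle : ∀ w ∈ C, w.toSubgraph ≤ F := fun w hw => le_biSup Walk.toSubgraph hw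
  have hc : c ∈ F.verts := (hle w₀ hw₀).1 w₀.start_mem_verts_toSubgraph
  have hfin : Finite F.verts := by
    simp only [F, Subgraph.verts_iSup]
    exact C.finite_toSet.biUnion fun w _ => by
      simpa only [Walk.verts_toSubgraph] using w.support.finite_toSet
  let lift : F.coe.Walk ⟨c, hc⟩ ⟨c, hc⟩ → G.Walk c c := Walk.map F.hom
  have hlift : Injective lift := Walk.map_injective_of_injective F.hom_injective _ _
  let C' := C.preimage lift hlift.injOn
  have hcard : C'.card = C.card := by
    have hrange : ∀ w ∈ C, w ∈ range lift := fun w hw => exists_walk_map_hom_eq (hle w hw) hc hc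
    rw [← Finset.card_image_of_injective C' hlift, Finset.image_preimage,
      Finset.filter_true_of_mem hrange]
  have hC' : ∀ w ∈ C', w.IsCycle ∧ w.length = n := fun w hw => by
    rw [← Walk.isCycle_map_iff_of_injective F.hom_injective, ← Walk.length_map F.hom]
    exact hC _ (Finset.mem_preimage.mp hw)
  have : Fintype (F.coe.neighborSet ⟨c, hc⟩) := Fintype.ofFinite _
  have : Fintype (F.neighborSet c) :=
    ((Set.toFinite F.verts).subset (F.neighborSet_subset_verts c)).fintype
  calc (C.card : ℝ≥0∞) = C'.card := by rw [hcard]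
    _ ≤ F.coe.degree ⟨c, hc⟩ * hashimotoRadius F.coe ^ n :=
      card_cycles_le_degree_mul_hashimotoRadius_pow hC'
    _ ≤ G.degree c * limitRadius G ^ n := by
      gcongr
      · exact (F.coe_degree _).trans_le (F.degree_le c)
      · exact hashimotoRadius_coe_le_limitRadius F

end LimitRadius

section Resampling

open Measure

variable {ι : Type*} [DecidableEq ι] {X : ι → Type*} {mX : ∀ i, MeasurableSpace (X i)}

theorem measurable_update_fst_snd (v : ι) :
    Measurable fun z : X v × (∀ i, X i) => update z.2 v z.1 := by
  refine measurable_pi_lambda _ fun i => ?_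
  rcases eq_or_ne i v with rfl | h
  · simpa only [update_self] using measurable_fst
  · simp only [update_of_ne h]
    exact (measurable_pi_apply i).comp measurable_snd

variable (μ : ∀ i, Measure (X i)) [∀ i, IsProbabilityMeasure (μ i)]

theorem infinitePi_map_update (v : ι) :
    ((μ v).prod (infinitePi μ)).map (fun z => update z.2 v z.1) = infinitePi μ := by
  refine eq_infinitePi μ fun s t ht => ?_
  have hpreimage : (fun z : X v × (∀ i, X i) => update z.2 v z.1) ⁻¹' (s : Set ι).pi t =
      (if v ∈ s then t v else Set.univ) ×ˢ ((s.erase v : Finset ι) : Set ι).pi t := by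
    ext ⟨x, f⟩
    simp only [Set.mem_preimage, Set.mem_pi, Set.mem_prod, Finset.mem_coe, Finset.mem_erase]
    constructor
    · refine fun h => ⟨?_, fun i hi => by simpa [update_of_ne hi.1] using h i hi.2⟩
      split_ifs with hv
      · simpa using h v hv
      · trivial
    · rintro ⟨hx, hf⟩ i hi
      rcases eq_or_ne i v with rfl | h
      · simpa [hi] using hx
      · simpa [update_of_ne h] using hf i ⟨h, hi⟩
  rw [map_apply (measurable_update_fst_snd v) (.pi s.countable_toSet fun i _ => ht i), hpreimage,
    prod_prod, infinitePi_pi μ fun i _ => ht i]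
  split_ifs with hv
  · rw [Finset.mul_prod_erase s (fun i => μ i (t i)) hv]
  · rw [measure_univ, one_mul, Finset.erase_eq_of_notMem hv]

variable {μ} {v : ι}

theorem infinitePi_apply_mem_inter {T : Set (X v)} (hT : MeasurableSet T) {D : Set (∀ i, X i)}
    (hD : MeasurableSet D) (hupdate : ∀ u t, update u v t ∈ D ↔ u ∈ D) :
    infinitePi μ {u | u v ∈ T ∧ u ∈ D} = μ v T * infinitePi μ D := by
  have hmeas : MeasurableSet {u : ∀ i, X i | u v ∈ T ∧ u ∈ D} :=
    (measurable_pi_apply v hT).inter hD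
  have hpreimage : (fun z : X v × (∀ i, X i) => update z.2 v z.1) ⁻¹' {u | u v ∈ T ∧ u ∈ D} =
      T ×ˢ D := by
    ext z
    simp [hupdate]
  rw [← infinitePi_map_update μ v, map_apply (measurable_update_fst_snd v) hmeas, hpreimage,
    prod_prod, infinitePi_map_update]

theorem ae_exists_update {T : Set (X v)} (hT : μ v T ≠ 0) {Q : (∀ i, X i) → Prop}
    (hQ : ∀ᵐ u ∂infinitePi μ, Q u) : ∀ᵐ u ∂infinitePi μ, ∃ t ∈ T, Q (update u v t) := by
  have hprod : ∀ᵐ z ∂(infinitePi μ).prod (μ v), Q (update z.1 v z.2) := by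
    rw [← infinitePi_map_update μ v] at hQ
    have := ae_of_ae_map (measurable_update_fst_snd v).aemeasurable hQ
    rw [← prod_swap] at this
    exact ae_of_ae_map measurable_swap.aemeasurable this
  filter_upwards [ae_ae_of_ae_prod hprod] with u hu
  exact ((frequently_ae_mem_iff.mpr hT).and_eventually hu).exists

end Resampling

section Labels

open Measure unitInterval

variable {p q : I}

/-- The law of independent uniform labels on the vertices. Opening the vertices with label at most
`p` realizes site percolation with parameter `p` simultaneously for all `p`. -/
noncomputable def labelLaw (V : Type*) : Measure (V → I) :=
  infinitePi fun _ => volume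

instance : IsProbabilityMeasure (labelLaw V) := by
  unfold labelLaw
  infer_instance

/-- The set of open vertices at level `p` for the labels `u`. -/
def openSites (p : I) (u : V → I) : Set V :=
  {v | u v ≤ p}

theorem openSites_mono (h : p ≤ q) (u : V → I) : openSites p u ⊆ openSites q u :=
  fun _ hv => le_trans hv h

theorem openSites_update_of_lt [DecidableEq V] {t : I} (ht : p < t) (u : V → I) (v : V) :
    openSites p (update u v t) = openSites p u \ {v} := by
  ext x
  rcases eq_or_ne x v with rfl | h
  · simp [openSites, ht]
  · simp [openSites, h]

theorem openSites_update_sdiff [DecidableEq V] (p : I) (u : V → I) (v : V) (t : I) :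
    openSites p (update u v t) \ {v} = openSites p u \ {v} := by
  ext x
  rcases eq_or_ne x v with rfl | h
  · simp
  · simp [openSites, h]

theorem map_le_volume (p : I) :
    (volume : Measure I).map (· ≤ p) =
      toNNReal p • dirac True + toNNReal (σ p) • dirac False := by
  have hmeas : Measurable fun t : I => t ≤ p := measurableSet_setOfPred.mp measurableSet_Iic
  refine ext_of_singleton fun P => ?_
  rw [map_apply hmeas .of_discrete]
  have hcoe (r : I) : ENNReal.ofReal r = toNNReal r := ENNReal.ofReal_eq_coe_nnreal r.2.1
  by_cases hP : P
  · have hpreimage : (· ≤ p) ⁻¹' {P} = Set.Iic p := by ext; simp [hP]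
    rw [hpreimage, volume_Iic, hcoe]
    simp [hP]
  · have hpreimage : (· ≤ p) ⁻¹' {P} = Set.Ioi p := by ext; simp [hP]
    rw [hpreimage, volume_Ioi, ← coe_symm_eq, hcoe]
    simp [hP]

theorem measurable_openSites (p : I) : Measurable (openSites p : (V → I) → Set V) :=
  measurable_set_iff.mpr fun v =>
    measurableSet_setOfPred.mp (measurableSet_Iic.preimage (measurable_pi_apply v))

theorem map_openSites_labelLaw (p : I) :
    (labelLaw V).map (openSites p) = ProbabilityTheory.setBernoulli Set.univ p := by
  have hmeas : Measurable fun t : I => t ≤ p := measurableSet_setOfPred.mp measurableSet_Iic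
  have hsetOf : Measurable fun P : V → Prop => {v | P v} := MeasurableEquiv.setOfPred.measurable
  simp only [ProbabilityTheory.setBernoulli_eq_map, Set.mem_univ, ← map_le_volume]
  rw [← infinitePi_map_pi (fun _ => volume) fun _ => hmeas, map_map hsetOf (by fun_prop)]
  rfl

theorem labelLaw_subset_openSites (F : Finset V) (p : I) :
    labelLaw V {u | ↑F ⊆ openSites p u} = ENNReal.ofReal p ^ F.card := by
  have hset : {u : V → I | ↑F ⊆ openSites p u} = (F : Set V).pi fun _ => Set.Iic p := rfl
  rw [hset, labelLaw, infinitePi_pi _ fun _ _ => measurableSet_Iic]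
  simp

theorem ae_forall_openSites_sdiff [Countable V] (hp : p < 1) {Q : Set V → Prop}
    (hQ : ∀ᵐ ω ∂ProbabilityTheory.setBernoulli Set.univ p, Q ω) :
    ∀ᵐ u ∂labelLaw V, ∀ B : Finset V, Q (openSites p u \ B) := by
  classical
  rw [ae_all_iff]
  intro B
  induction B using Finset.induction_on with
  | empty =>
    rw [← map_openSites_labelLaw] at hQ
    simpa using ae_of_ae_map (measurable_openSites p).aemeasurable hQ
  | insert v B _ ih =>
    have hv : volume (Set.Ioi p) ≠ 0 := by simpa using hp
    filter_upwards [ae_exists_update (μ := fun _ : V => volume) (v := v) hv ih]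
      with u ⟨t, ht, hu⟩
    rwa [openSites_update_of_lt ht, Set.sdiff_sdiff, ← Set.insert_eq, ← Finset.coe_insert] at hu

end Labels

section Clusters

variable {G : SimpleGraph V} {ω ω' : Set V} {x y z : V}

/-- The vertices `x` and `y` are open and lie in the same open cluster. -/
def Joined (G : SimpleGraph V) (ω : Set V) (x y : V) : Prop :=
  ∃ w : G.Walk x y, ∀ v ∈ w.support, v ∈ ω

/-- The vertex `x` lies in an infinite open cluster. -/
def Percolates (G : SimpleGraph V) (ω : Set V) (x : V) : Prop :=
  {y | Joined G ω x y}.Infinite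

/-- The infinite open cluster exists and is unique, also after closing finitely many vertices. -/
def RobustlyUnique (G : SimpleGraph V) (ω : Set V) : Prop :=
  ∀ B : Finset V, HasUniqueInfiniteCluster G (ω \ B)

theorem Joined.mono (h : ω ⊆ ω') (hxy : Joined G ω x y) : Joined G ω' x y :=
  hxy.imp fun _ hw v hv => h (hw v hv)

theorem Joined.symm (hxy : Joined G ω x y) : Joined G ω y x := by
  obtain ⟨w, hw⟩ := hxy
  exact ⟨w.reverse, fun v hv => hw v (by simpa using hv)⟩

theorem Joined.trans (hxy : Joined G ω x y) (hyz : Joined G ω y z) : Joined G ω x z := by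
  obtain ⟨w, hw⟩ := hxy
  obtain ⟨w', hw'⟩ := hyz
  refine ⟨w.append w', fun v hv => ?_⟩
  rw [Walk.mem_support_append_iff] at hv
  exact hv.elim (hw v) (hw' v)

theorem joined_self (hx : x ∈ ω) : Joined G ω x x :=
  ⟨Walk.nil, by simpa using hx⟩

theorem Joined.left_mem (hxy : Joined G ω x y) : x ∈ ω := by
  obtain ⟨w, hw⟩ := hxy
  exact hw x w.start_mem_support

theorem joined_iff_reachable (hx : x ∈ ω) (hy : y ∈ ω) :
    Joined G ω x y ↔ (G.induce ω).Reachable ⟨x, hx⟩ ⟨y, hy⟩ := by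
  constructor
  · rintro ⟨w, hw⟩
    exact ⟨w.induce ω hw⟩
  · rintro ⟨w⟩
    refine ⟨w.map (Embedding.induce ω).toHom, fun v hv => ?_⟩
    obtain ⟨v, -, rfl⟩ := List.mem_map.mp (w.support_map _ ▸ hv)
    exact v.2

theorem Percolates.mem (h : Percolates G ω x) : x ∈ ω :=
  Joined.left_mem h.nonempty.some_mem

theorem Percolates.mono (h : ω ⊆ ω') (hx : Percolates G ω x) : Percolates G ω' x :=
  Set.Infinite.mono (fun _ hy => Joined.mono h hy) hx

theorem Percolates.of_joined (hx : Percolates G ω x) (hxy : Joined G ω x y) : Percolates G ω y :=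
  Set.Infinite.mono (fun _ hz => hxy.symm.trans hz) hx

theorem percolates_iff_infinite_supp (hx : x ∈ ω) :
    Percolates G ω x ↔ ((G.induce ω).connectedComponentMk ⟨x, hx⟩).supp.Infinite := by
  have himage : {y | Joined G ω x y} =
      Subtype.val '' ((G.induce ω).connectedComponentMk ⟨x, hx⟩).supp := by
    ext y
    simp only [Set.mem_ofPred_eq, Set.mem_image, ConnectedComponent.mem_supp_iff,
      ConnectedComponent.eq]
    constructor
    · intro hxy
      have hy : y ∈ ω := hxy.symm.left_mem
      exact ⟨⟨y, hy⟩, ((joined_iff_reachable hx hy).mp hxy).symm, rfl⟩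
    · rintro ⟨z, hz, rfl⟩
      exact (joined_iff_reachable hx z.2).mpr hz.symm
  rw [Percolates, himage, Set.infinite_image_iff Subtype.val_injective.injOn]

theorem HasUniqueInfiniteCluster.exists_percolates (h : HasUniqueInfiniteCluster G ω) :
    ∃ x, Percolates G ω x := by
  obtain ⟨C, hC, -⟩ := h
  obtain ⟨x, rfl⟩ := C.exists_rep
  exact ⟨x, (percolates_iff_infinite_supp x.2).mpr hC⟩

theorem HasUniqueInfiniteCluster.joined (h : HasUniqueInfiniteCluster G ω)
    (hx : Percolates G ω x) (hy : Percolates G ω y) : Joined G ω x y := by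
  rw [joined_iff_reachable hx.mem hy.mem, ← ConnectedComponent.eq]
  exact h.unique ((percolates_iff_infinite_supp hx.mem).mp hx)
    ((percolates_iff_infinite_supp hy.mem).mp hy)

theorem Joined.sdiff_or_sdiff {v : V} (hxy : Joined G ω x y) (hxv : x ≠ v) :
    Joined G (ω \ {v}) x y ∨ Joined G (ω \ {x}) v y := by
  classical
  obtain ⟨w, hw⟩ := hxy.symm
  have hopen : ∀ u ∈ w.bypass.support, u ∈ ω := fun u hu =>
    hw u (w.support_bypass_subset_support hu)
  by_cases hv : v ∈ w.bypass.support
  · refine .inr (Joined.symm ⟨w.bypass.takeUntil v hv, fun u hu =>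
      ⟨hopen u (w.bypass.support_takeUntil_subset_support hv hu), ?_⟩⟩)
    rintro rfl
    exact Walk.endpoint_notMem_support_takeUntil w.bypass_isPath hv hxv hu
  · refine .inl (Joined.symm ⟨w.bypass, fun u hu => ⟨hopen u hu, ?_⟩⟩)
    rintro rfl
    exact hv hu

end Clusters

section ClusterMeasurability

variable {G : SimpleGraph V} [Countable V]

theorem countable_walk (x y : V) : Countable (G.Walk x y) :=
  Injective.countable (f := Walk.support) fun _ _ h => Walk.ext_support h

variable {Ω : Type*} [MeasurableSpace Ω] {f : Ω → Set V}

theorem measurableSet_joined (G : SimpleGraph V) (hf : Measurable f) (x y : V) :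
    MeasurableSet {a | Joined G (f a) x y} := by
  have : Countable (G.Walk x y) := countable_walk x y
  simp only [Joined, Set.ofPred_exists]
  refine .iUnion fun w => ?_
  simp only [Set.ofPred_forall]
  exact .iInter fun v => .iInter fun _ =>
    measurableSet_setOfPred.mpr ((measurable_set_mem v).comp hf)

theorem measurableSet_percolates (G : SimpleGraph V) (hf : Measurable f) (x : V) :
    MeasurableSet {a | Percolates G (f a) x} := by
  have hset : {a | Percolates G (f a) x} =
      ⋂ F : Finset V, ⋃ y ∈ (F : Set V)ᶜ, {a | Joined G (f a) x y} := by
    ext a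
    simp only [Set.mem_ofPred_eq, Set.mem_iInter, Set.mem_iUnion, exists_prop]
    constructor
    · intro h F
      obtain ⟨y, hxy, hy⟩ := h.exists_notMem_finset F
      exact ⟨y, hy, hxy⟩
    · intro h hfin
      obtain ⟨y, hy, hxy⟩ := h hfin.toFinset
      exact hy (by simpa using hxy)
  rw [hset]
  exact .iInter fun F => .biUnion (Set.to_countable _) fun y _ => measurableSet_joined G hf x y

end ClusterMeasurability

section CutSites

variable {G : SimpleGraph V} {ω ω' : Set V} {x v w : V}

theorem RobustlyUnique.unique (h : RobustlyUnique G ω) : HasUniqueInfiniteCluster G ω := by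
  simpa using h ∅

theorem RobustlyUnique.unique_sdiff_singleton (h : RobustlyUnique G ω) (v : V) :
    HasUniqueInfiniteCluster G (ω \ {v}) := by
  simpa using h {v}

theorem RobustlyUnique.exists_percolates_sdiff_pair (h : RobustlyUnique G ω) (v w : V) :
    ∃ y, Percolates G (ω \ {v}) y ∧ Percolates G (ω \ {w}) y := by
  classical
  obtain ⟨y, hy⟩ := (h {v, w}).exists_percolates
  exact ⟨y, hy.mono (Set.sdiff_subset_sdiff_right (by simp)),
    hy.mono (Set.sdiff_subset_sdiff_right (by simp))⟩

/-- After closing `v`, not even the configuration `ω'`, which is meant to contain `ω`, joins `x` to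
an infinite cluster of `ω`. -/
def IsCutSite (G : SimpleGraph V) (ω ω' : Set V) (x v : V) : Prop :=
  v ≠ x ∧ ∀ y, Percolates G (ω \ {v}) y → ¬Joined G (ω' \ {v}) x y

/-- The state of `v` in `ω` decides whether `x` is joined to an infinite cluster of `ω`, and
closing `v` in `ω'` separates `x` from the infinite clusters of `ω`. Adding and removing `v`
explicitly makes this notion independent of the state of `v`. -/
def IsPivotal (G : SimpleGraph V) (ω ω' : Set V) (x v : V) : Prop :=
  (∃ y, Percolates G (ω \ {v}) y ∧ Joined G (insert v ω) x y) ∧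
    ∀ y, Percolates G (ω \ {v}) y → ¬Joined G (ω' \ {v}) x y

theorem IsCutSite.mem (hsub : ω ⊆ ω') (hx : Percolates G ω x) (h : IsCutSite G ω ω' x v) :
    v ∈ ω := by
  by_contra hv
  rw [IsCutSite, Set.sdiff_singleton_eq_self hv] at h
  exact h.2 x hx (joined_self ⟨hsub hx.mem, h.1.symm⟩)

theorem IsCutSite.percolates (hsub : ω ⊆ ω') (hω : RobustlyUnique G ω) (hx : Percolates G ω x)
    (h : IsCutSite G ω ω' x v) : Percolates G ω v := by
  obtain ⟨y, hy⟩ := (hω.unique_sdiff_singleton v).exists_percolates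
  have hy' : Percolates G ω y := hy.mono Set.sdiff_subset
  rcases (hω.unique.joined hx hy').sdiff_or_sdiff h.1.symm with hxy | hvy
  · exact absurd (hxy.mono (Set.sdiff_subset_sdiff_left hsub)) (h.2 y hy)
  · exact hy'.of_joined (hvy.mono Set.sdiff_subset).symm

theorem IsCutSite.trans (hsub : ω ⊆ ω') (hω : RobustlyUnique G ω) (hx : Percolates G ω x)
    (hv : IsCutSite G ω ω' x v) (hw : IsCutSite G ω ω' v w) : IsCutSite G ω ω' x w := by
  obtain ⟨y, hyv, hyw⟩ := hω.exists_percolates_sdiff_pair v w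
  refine ⟨?_, fun y' hy' hxy' => ?_⟩
  · rintro rfl
    have hwy : Joined G ω w y := hω.unique.joined hx (hyv.mono Set.sdiff_subset)
    rcases (hwy.mono hsub).sdiff_or_sdiff hv.1.symm with hwy | hvy
    · exact hv.2 y hyv hwy
    · exact hw.2 y hyw hvy
  · have hy'y : Joined G (ω \ {w}) y' y := (hω.unique_sdiff_singleton w).joined hy' hyw
    have hxy : Joined G (ω' \ {w}) x y :=
      hxy'.trans (hy'y.mono (Set.sdiff_subset_sdiff_left hsub))
    rcases hxy.sdiff_or_sdiff hv.1.symm with hxy | hvy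
    · exact hv.2 y hyv (hxy.mono (Set.sdiff_subset_sdiff_left Set.sdiff_subset))
    · exact hw.2 y hyw (hvy.mono Set.sdiff_subset)

theorem exists_percolates_forall_not_isCutSite (hsub : ω ⊆ ω') (hω : RobustlyUnique G ω)
    (hfin : ∀ x, Percolates G ω x → {v | IsCutSite G ω ω' x v}.Finite) :
    ∃ c, Percolates G ω c ∧ ∀ v, ¬IsCutSite G ω ω' c v := by
  obtain ⟨x, hx⟩ := hω.unique.exists_percolates
  induction h : {v | IsCutSite G ω ω' x v}.ncard using Nat.strong_induction_on generalizing x with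
  | _ n ih =>
    by_cases hcut : ∃ v, IsCutSite G ω ω' x v
    · obtain ⟨v, hv⟩ := hcut
      refine ih _ (h ▸ Set.ncard_lt_ncard ?_ (hfin x hx)) v (hv.percolates hsub hω hx) rfl
      exact ⟨fun w hw => hv.trans hsub hω hx hw, fun hle => (hle hv : IsCutSite G ω ω' v v).1 rfl⟩
    · exact ⟨x, hx, not_exists.mp hcut⟩

theorem IsCutSite.isPivotal (hω : RobustlyUnique G ω) (hx : Percolates G ω x)
    (h : IsCutSite G ω ω' x v) : IsPivotal G ω ω' x v := by
  obtain ⟨y, hy⟩ := (hω.unique_sdiff_singleton v).exists_percolates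
  exact ⟨⟨y, hy, (hω.unique.joined hx (hy.mono Set.sdiff_subset)).mono (Set.subset_insert _ _)⟩,
    h.2⟩

theorem IsPivotal.eq_of_notMem_of_mem (hsub : ω ⊆ ω') (hv : IsPivotal G ω ω' x v) (hvω : v ∉ ω)
    (hw : IsPivotal G ω ω' x w) (hwω : w ∉ ω) (hwω' : w ∈ ω') : v = w := by
  by_contra hne
  obtain ⟨⟨y, hy, hxy⟩, -⟩ := hw
  rw [Set.sdiff_singleton_eq_self hwω] at hy
  have hinsert : insert w ω ⊆ ω' \ {v} :=
    Set.insert_subset ⟨hwω', fun h => hne h.symm⟩ (Set.subset_sdiff_singleton hsub hvω)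
  exact hv.2 y (by rwa [Set.sdiff_singleton_eq_self hvω]) (hxy.mono hinsert)

end CutSites

section FiniteCutSites

open Measure unitInterval

variable {G : SimpleGraph V} {p q : I}

theorem isPivotal_openSites_update_iff [DecidableEq V] (x v : V) (u : V → I) (t : I) :
    IsPivotal G (openSites p (update u v t)) (openSites q (update u v t)) x v ↔
      IsPivotal G (openSites p u) (openSites q u) x v := by
  simp only [IsPivotal, openSites_update_sdiff,
    ← Set.insert_sdiff_singleton (s := openSites p _) (a := v)]

variable [Countable V]

theorem measurableSet_isPivotal (G : SimpleGraph V) (p q : I) (x v : V) :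
    MeasurableSet {u | IsPivotal G (openSites p u) (openSites q u) x v} := by
  have hdiff (r : I) : Measurable fun u : V → I => openSites r u \ {v} :=
    measurable_set_iff.mpr fun a =>
      ((measurable_set_mem a).comp (measurable_openSites r)).and measurable_const
  have hinsert : Measurable fun u : V → I => insert v (openSites p u) :=
    measurable_set_iff.mpr fun a =>
      measurable_const.or ((measurable_set_mem a).comp (measurable_openSites p))
  have hperc (y : V) := measurableSet_percolates G (hdiff p) y
  simp only [IsPivotal, imp_iff_not_or, Set.ofPred_and, Set.ofPred_exists, Set.ofPred_forall,
    Set.ofPred_or]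
  exact .inter
    (.iUnion fun y => (hperc y).inter (measurableSet_joined G hinsert x y))
    (.iInter fun y => (hperc y).compl.union (measurableSet_joined G (hdiff q) x y).compl)

theorem tsum_labelLaw_isPivotal_ne_top (hpq : p < q) (x : V) :
    ∑' v, labelLaw V {u | v ∈ openSites p u ∧ IsPivotal G (openSites p u) (openSites q u) x v} ≠
      ∞ := by
  classical
  let D (v : V) : Set (V → I) := {u | IsPivotal G (openSites p u) (openSites q u) x v}
  have hD (v : V) : MeasurableSet (D v) := measurableSet_isPivotal G p q x v
  have hinter (v : V) {T : Set I} (hT : MeasurableSet T) :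
      labelLaw V {u | u v ∈ T ∧ u ∈ D v} = volume T * labelLaw V (D v) :=
    infinitePi_apply_mem_inter (μ := fun _ => volume) hT (hD v) (isPivotal_openSites_update_iff x v)
  have hsprinkled : ∑' v, labelLaw V {u | u v ∈ Set.Ioc p q ∧ u ∈ D v} ≤ 1 := by
    rw [← measure_iUnion]
    · exact prob_le_one
    · refine fun v w hne => Set.disjoint_left.mpr ?_
      rintro u ⟨hv, hvD⟩ ⟨hw, hwD⟩
      exact hne (hvD.eq_of_notMem_of_mem (openSites_mono hpq.le u) hv.1.not_ge hwD hw.1.not_ge hw.2)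
    · exact fun v => (measurable_pi_apply v measurableSet_Ioc).inter (hD v)
  simp only [hinter _ measurableSet_Ioc, ENNReal.tsum_mul_left] at hsprinkled
  change ∑' v, labelLaw V {u | u v ∈ Set.Iic p ∧ u ∈ D v} ≠ ∞
  simp only [hinter _ measurableSet_Iic, ENNReal.tsum_mul_left]
  refine ENNReal.mul_ne_top (measure_ne_top _ _) fun htop => ?_
  rw [htop, ENNReal.mul_top (by simpa using hpq)] at hsprinkled
  simp at hsprinkled

theorem ae_forall_finite_isCutSite (hpq : p < q)
    (hp : ∀ᵐ u ∂labelLaw V, RobustlyUnique G (openSites p u)) :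
    ∀ᵐ u ∂labelLaw V, ∀ x, Percolates G (openSites p u) x →
      {v | IsCutSite G (openSites p u) (openSites q u) x v}.Finite := by
  have hfin : ∀ᵐ u ∂labelLaw V, ∀ x,
      {v | v ∈ openSites p u ∧ IsPivotal G (openSites p u) (openSites q u) x v}.Finite :=
    ae_all_iff.mpr fun x => ae_finite_setOfPred_mem (tsum_labelLaw_isPivotal_ne_top hpq x)
  filter_upwards [hfin, hp] with u hu hrobust x hx
  exact (hu x).subset fun v hv => ⟨hv.mem (openSites_mono hpq.le u) hx, hv.isPivotal hrobust hx⟩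

end FiniteCutSites

section Fans

variable {X : SimpleGraph V} {T : Set V}

/-- A fan with two blades: two paths from `c` to `T` that share only `c` and meet `T` only in their
last vertices. -/
structure IsFan (T : Set V) {c s t : V} (p : X.Walk c s) (q : X.Walk c t) : Prop where
  left_isPath : p.IsPath
  right_isPath : q.IsPath
  left_mem : s ∈ T
  right_mem : t ∈ T
  eq_start : ∀ u ∈ p.support, u ∈ q.support → u = c
  left_eq_end : ∀ u ∈ p.support, u ∈ T → u = s
  right_eq_end : ∀ u ∈ q.support, u ∈ T → u = t

theorem IsFan.symm {c s t : V} {p : X.Walk c s} {q : X.Walk c t} (h : IsFan T p q) :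
    IsFan T q p :=
  ⟨h.right_isPath, h.left_isPath, h.right_mem, h.left_mem, fun u hq hp => h.eq_start u hp hq,
    h.right_eq_end, h.left_eq_end⟩

theorem IsFan.ne {c s t : V} {p : X.Walk c s} {q : X.Walk c t} (h : IsFan T p q) (hc : c ∉ T) :
    s ≠ t := by
  rintro rfl
  obtain rfl := h.eq_start s p.end_mem_support q.end_mem_support
  exact hc h.left_mem

theorem exists_isPath_forall_mem_imp_eq {a t : V} (Q : X.Walk a t) (ht : t ∈ T) :
    ∃ t' ∈ T, ∃ R : X.Walk a t', R.IsPath ∧ R.support ⊆ Q.support ∧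
      ∀ u ∈ R.support, u ∈ T → u = t' := by
  classical
  obtain ⟨t', ht', ht'Q, hfirst⟩ := Q.exists_mem_support_forall_mem_support_imp_eq
    (Q.support.toFinset.filter (· ∈ T)) ⟨t, by simpa using ht⟩
  have hsub := (Q.takeUntil t' ht'Q).support_bypass_subset_support
  have hsubQ := Q.support_takeUntil_subset_support ht'Q
  refine ⟨t', (Finset.mem_filter.mp ht').2, (Q.takeUntil t' ht'Q).bypass, Walk.bypass_isPath _,
    fun u hu => hsubQ (hsub hu), fun u hu huT => hfirst u ?_ (hsub hu)⟩
  simpa using ⟨hsubQ (hsub hu), huT⟩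

theorem exists_isPath_between {A : Set V} {a t : V} (Q : X.Walk a t) (ha : a ∈ A) (ht : t ∈ T) :
    ∃ z ∈ A, ∃ t' ∈ T, ∃ R : X.Walk z t', R.IsPath ∧ R.support ⊆ Q.support ∧
      (∀ u ∈ R.support, u ∈ A → u = z) ∧ ∀ u ∈ R.support, u ∈ T → u = t' := by
  obtain ⟨t', ht', R, -, hRQ, hRT⟩ := exists_isPath_forall_mem_imp_eq Q ht
  obtain ⟨z, hz, R', hR', hR'R, hR'A⟩ := exists_isPath_forall_mem_imp_eq R.reverse ha
  have hsub : R'.reverse.support ⊆ R.support := fun u hu => by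
    simpa using hR'R (by simpa using hu)
  exact ⟨z, hz, t', ht', R'.reverse, hR'.reverse, fun u hu => hRQ (hsub hu),
    fun u hu => hR'A u (by simpa using hu), fun u hu => hRT u (hsub hu)⟩

theorem start_notMem_support_tail {u v : V} {p : X.Walk u v} (hp : p.IsPath) :
    u ∉ p.support.tail := by
  have hnodup := hp.support_nodup
  rw [← Walk.cons_tail_support, List.nodup_cons] at hnodup
  exact hnodup.1

theorem isPath_append {u v w : V} {p : X.Walk u v} {q : X.Walk v w} (hp : p.IsPath)
    (hq : q.IsPath) (h : ∀ x ∈ p.support, x ∈ q.support → x = v) : (p.append q).IsPath := by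
  rw [Walk.isPath_def, Walk.support_append, List.nodup_append']
  refine ⟨hp.support_nodup, hq.support_nodup.tail, fun x hxp hxq => ?_⟩
  obtain rfl := h x hxp (List.mem_of_mem_tail hxq)
  exact start_notMem_support_tail hq hxq

theorem isCycle_append {u v : V} {p : X.Walk u v} {q : X.Walk v u} (hp : p.IsPath)
    (hq : q.IsPath) (h : ∀ x ∈ p.support, x ∈ q.support → x = u ∨ x = v) (hn : 1 < p.length) :
    (p.append q).IsCycle := by
  refine hp.isCycle_append hq (fun x hxp hxq => ?_) (.inl hn)
  rcases h x (List.mem_of_mem_tail hxp) (List.mem_of_mem_tail hxq) with rfl | rfl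
  · exact start_notMem_support_tail hp hxp
  · exact start_notMem_support_tail hq hxq

theorem isFan_takeUntil_append [DecidableEq V] {c t t' z : V} {p q : X.Walk c t}
    (hp : p.IsPath) (hq : q.IsPath) (hpq : ∀ u ∈ p.support, u ∈ q.support → u = c ∨ u = t)
    (hpT : ∀ u ∈ p.support, u ∈ T → u = t) (hqT : ∀ u ∈ q.support, u ∈ T → u = t)
    (ht : t ∈ T) (ht' : t' ∈ T) (hz : z ∈ p.support) (R : X.Walk z t') (hR : R.IsPath)
    (htR : t ∉ R.support) (hRp : ∀ u ∈ R.support, u ∈ p.support → u = z)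
    (hRq : ∀ u ∈ R.support, u ∈ q.support → u = z) (hRT : ∀ u ∈ R.support, u ∈ T → u = t') :
    IsFan T ((p.takeUntil z hz).append R) q := by
  have hsub := p.support_takeUntil_subset_support hz
  have hzt : z ≠ t := fun h => htR (h ▸ R.start_mem_support)
  have htp : t ∉ (p.takeUntil z hz).support :=
    Walk.endpoint_notMem_support_takeUntil hp hz hzt.symm
  refine ⟨isPath_append (hp.takeUntil hz) hR fun u hu huR => hRp u huR (hsub hu), hq, ht', ht,
    fun u hu huq => ?_, fun u hu huT => ?_, hqT⟩ <;>
    rcases (Walk.mem_support_append_iff _ _).mp hu with hup | huR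
  · exact (hpq u (hsub hup) huq).resolve_right fun h => htp (h ▸ hup)
  · obtain rfl := hRq u huR huq
    exact (hpq u hz huq).resolve_right hzt
  · exact absurd (hpT u (hsub hup) huT ▸ hup) htp
  · exact hRT u huR huT

theorem exists_isFan_of_forall_mem_imp_eq_or_eq {c t t₁ : V} {p q : X.Walk c t} (hp : p.IsPath)
    (hq : q.IsPath) (hpq : ∀ u ∈ p.support, u ∈ q.support → u = c ∨ u = t)
    (hpT : ∀ u ∈ p.support, u ∈ T → u = t) (hqT : ∀ u ∈ q.support, u ∈ T → u = t) (ht : t ∈ T)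
    (ht₁ : t₁ ∈ T) (h : Joined X {t}ᶜ c t₁) :
    ∃ (s₁ s₂ : V) (p' : X.Walk c s₁) (q' : X.Walk c s₂), IsFan T p' q' := by
  classical
  obtain ⟨Q, hQ⟩ := h
  obtain ⟨z, hz, t', ht', R, hR, hRQ, hRA, hRT⟩ := exists_isPath_between
    (A := {u | u ∈ p.support ∨ u ∈ q.support}) Q (.inl p.start_mem_support) ht₁
  have htR : t ∉ R.support := fun htR => hQ t (hRQ htR) rfl
  have hRp : ∀ u ∈ R.support, u ∈ p.support → u = z := fun u hu hup => hRA u hu (.inl hup)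
  have hRq : ∀ u ∈ R.support, u ∈ q.support → u = z := fun u hu huq => hRA u hu (.inr huq)
  rcases hz with hz | hz
  · exact ⟨_, _, _, _,
      isFan_takeUntil_append hp hq hpq hpT hqT ht ht' hz R hR htR hRp hRq hRT⟩
  · exact ⟨_, _, _, _, isFan_takeUntil_append hq hp (fun u huq hup => hpq u hup huq) hqT hpT ht ht'
      hz R hR htR hRq hRp hRT⟩

theorem exists_isFan_of_isFan_insert {c s t y : V} (ht : t ∈ T) (hy : y ∉ T) (hyt : X.Adj y t)
    {p : X.Walk c y} {q : X.Walk c s} (h : IsFan (insert y T) p q) (hs : s ∈ T)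
    (hsep : ∃ t' ∈ T, Joined X {t}ᶜ c t') :
    ∃ (s₁ s₂ : V) (p' : X.Walk c s₁) (q' : X.Walk c s₂), IsFan T p' q' := by
  have hpT : ∀ u ∈ p.support, u ∉ T := fun u hu huT =>
    hy (h.left_eq_end u hu (.inr huT) ▸ huT)
  have hqT : ∀ u ∈ q.support, u ∈ T → u = s := fun u hu huT => h.right_eq_end u hu (.inr huT)
  have hp' : (p.concat hyt).IsPath := h.left_isPath.concat (fun htp => hpT t htp ht) hyt
  have hmem (u : V) : u ∈ (p.concat hyt).support ↔ u ∈ p.support ∨ u = t := by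
    simp [Walk.support_concat]
  have hp'T : ∀ u ∈ (p.concat hyt).support, u ∈ T → u = t := fun u hu huT =>
    ((hmem u).mp hu).resolve_left fun hup => hpT u hup huT
  have hinter : ∀ u ∈ (p.concat hyt).support, u ∈ q.support → u = c ∨ u = t := fun u hu huq =>
    ((hmem u).mp hu).imp_left fun hup => h.eq_start u hup huq
  rcases eq_or_ne s t with rfl | hst
  · obtain ⟨t', ht', hct'⟩ := hsep
    exact exists_isFan_of_forall_mem_imp_eq_or_eq hp' h.right_isPath hinter hp'T hqT ht ht' hct'
  · refine ⟨_, _, p.concat hyt, q, hp', h.right_isPath, ht, hs, fun u hu huq => ?_, hp'T, hqT⟩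
    exact (hinter u hu huq).resolve_right fun h => hst (hqT u huq (h ▸ ht) ▸ h)

theorem exists_isFan_of_walk {c t : V} (w : X.Walk t c) (ht : t ∈ T) (hc : c ∉ T)
    (hsep : ∀ v, v ≠ c → ∃ t ∈ T, Joined X {v}ᶜ c t) :
    ∃ (s₁ s₂ : V) (p : X.Walk c s₁) (q : X.Walk c s₂), IsFan T p q := by
  induction w generalizing T with
  | nil => exact absurd ht hc
  | @cons t y c hty w ih =>
    have htc : t ≠ c := fun h => hc (h ▸ ht)
    obtain ⟨t', ht', hct'⟩ := hsep t htc
    by_cases hyT : y ∈ T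
    · exact ih hyT hc hsep
    rcases eq_or_ne y c with rfl | hyc
    · have hpT : ∀ u ∈ hty.symm.toWalk.support, u ∈ T → u = t := fun u hu huT => by
        rcases (by simpa using hu : u = y ∨ u = t) with rfl | rfl
        · exact absurd huT hc
        · rfl
      have hp : hty.symm.toWalk.IsPath := by simp [hty.ne']
      exact exists_isFan_of_forall_mem_imp_eq_or_eq hp hp (by simp) hpT hpT ht ht' hct'
    have hc' : c ∉ insert y T := fun h => h.elim (fun h => hyc h.symm) hc
    obtain ⟨s₁, s₂, p, q, h⟩ := ih (T := insert y T) (.inl rfl) hc'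
      fun v hv => (hsep v hv).imp fun t h => ⟨.inr h.1, h.2⟩
    rcases h.left_mem with rfl | hs₁
    · have hs₂ : s₂ ∈ T := h.right_mem.resolve_left (h.ne hc').symm
      exact exists_isFan_of_isFan_insert ht hyT hty.symm h hs₂ ⟨t', ht', hct'⟩
    rcases h.right_mem with rfl | hs₂
    · exact exists_isFan_of_isFan_insert ht hyT hty.symm h.symm hs₁ ⟨t', ht', hct'⟩
    exact ⟨s₁, s₂, p, q, h.left_isPath, h.right_isPath, hs₁, hs₂, h.eq_start,
      fun u hu huT => h.left_eq_end u hu (.inr huT), fun u hu huT => h.right_eq_end u hu (.inr huT)⟩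

/-- A case of Menger's theorem. -/
theorem exists_isFan {c : V} (hc : c ∉ T) (hT : T.Nonempty)
    (hsep : ∀ v, v ≠ c → ∃ t ∈ T, Joined X {v}ᶜ c t) :
    ∃ (s₁ s₂ : V) (p : X.Walk c s₁) (q : X.Walk c s₂), IsFan T p q := by
  obtain ⟨t₀, ht₀⟩ := hT
  obtain ⟨t, ht, w, -⟩ := hsep t₀ fun h => hc (h ▸ ht₀)
  exact exists_isFan_of_walk w.reverse ht hc hsep

theorem exists_isCycle_of_forall_joined {c : V} (hc : c ∉ T) (hT : T.Nonempty)
    (hconn : ∀ s ∈ T, ∀ t ∈ T, Joined X T s t)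
    (hsep : ∀ v, v ≠ c → ∃ t ∈ T, Joined X {v}ᶜ c t) :
    ∃ C : X.Walk c c, C.IsCycle ∧ ∃ u ∈ C.support, u ∈ T := by
  classical
  obtain ⟨s, t, p, q, h⟩ := exists_isFan hc hT hsep
  obtain ⟨w, hw⟩ := hconn s h.left_mem t h.right_mem
  have hwT : ∀ u ∈ w.bypass.support, u ∈ T := fun u hu => hw u (w.support_bypass_subset_support hu)
  have hp : (p.append w.bypass).IsPath := isPath_append h.left_isPath w.bypass_isPath
    fun u hup huw => h.left_eq_end u hup (hwT u huw)
  have hcs : c ≠ s := fun e => hc (e ▸ h.left_mem)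
  refine ⟨_, isCycle_append hp h.right_isPath.reverse (fun u hu huq => ?_) ?_, s, by simp,
    h.left_mem⟩
  · rw [Walk.support_reverse, List.mem_reverse] at huq
    exact ((Walk.mem_support_append_iff _ _).mp hu).imp (fun hup => h.eq_start u hup huq)
      fun huw => h.right_eq_end u huq (hwT u huw)
  · have hplength := Walk.not_nil_iff_lt_length.mp (Walk.not_nil_of_ne hcs : ¬p.Nil)
    have hwlength := Walk.not_nil_iff_lt_length.mp (Walk.not_nil_of_ne (h.ne hc) : ¬w.bypass.Nil)
    rw [Walk.length_append]
    lia

end Fans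

section OpenCycles

variable {G : SimpleGraph V} {ω ω' : Set V} {c x y : V}

/-- The closed walks that traverse an open cycle through `c`, starting at `c`. -/
def openCycles (G : SimpleGraph V) (ω : Set V) (c : V) : Set (G.Walk c c) :=
  {C | C.IsCycle ∧ ∀ v ∈ C.support, v ∈ ω}

theorem Joined.induce (h : ω ⊆ ω') (hxy : Joined G ω x y) :
    Joined (G.induce ω') (Subtype.val ⁻¹' ω) ⟨x, h hxy.left_mem⟩ ⟨y, h hxy.symm.left_mem⟩ := by
  obtain ⟨w, hw⟩ := hxy
  refine ⟨w.induce ω' fun v hv => h (hw v hv), fun v hv => hw v ?_⟩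
  rw [Walk.support_induce] at hv
  simpa using hv

theorem Percolates.joined_setOf_percolates (hx : Percolates G ω x) (hxy : Joined G ω x y) :
    Joined G {z | Percolates G ω z} x y := by
  classical
  obtain ⟨w, hw⟩ := hxy
  exact ⟨w, fun v hv => hx.of_joined
    ⟨w.takeUntil v hv, fun u hu => hw u (w.support_takeUntil_subset_support hv hu)⟩⟩

theorem exists_mem_openCycles_of_forall_joined {T : Set V} (hTω : T ⊆ ω) (hc : c ∈ ω) (hcT : c ∉ T)
    (hT : T.Nonempty) (hconn : ∀ s ∈ T, ∀ t ∈ T, Joined G T s t)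
    (hsep : ∀ v, v ≠ c → ∃ t ∈ T, Joined G (ω \ {v}) c t) :
    ∃ C ∈ openCycles G ω c, ∃ u ∈ C.support, u ∈ T := by
  obtain ⟨C, hC, u, hu, huT⟩ := exists_isCycle_of_forall_joined (X := G.induce ω) (c := ⟨c, hc⟩)
    (T := Subtype.val ⁻¹' T) hcT (hT.preimage' (by simpa using hTω))
    (fun s hs t ht => (hconn s hs t ht).induce hTω) fun v hv => by
      obtain ⟨t, ht, hct⟩ := hsep v fun h => hv (Subtype.ext h)
      exact ⟨⟨t, hTω ht⟩, ht, (hct.induce Set.sdiff_subset).mono fun u hu huv => hu.2 (huv ▸ rfl)⟩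
  let f : G.induce ω →g G := (Embedding.induce ω).toHom
  have hsupport : (C.map f).support = C.support.map Subtype.val := C.support_map f
  refine ⟨C.map f, ⟨(Walk.isCycle_map_iff_of_injective Subtype.val_injective).mpr hC,
    fun v hv => ?_⟩, u, hsupport ▸ List.mem_map_of_mem hu, huT⟩
  obtain ⟨v, -, rfl⟩ := List.mem_map.mp (hsupport ▸ hv)
  exact v.2

theorem infinite_openCycles (hsub : ω ⊆ ω') (hω : RobustlyUnique G ω) (hc : Percolates G ω c)
    (hcut : ∀ v, ¬IsCutSite G ω ω' c v) : (openCycles G ω' c).Infinite := by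
  classical
  intro hfin
  let B : Finset V := insert c (hfin.toFinset.biUnion fun C => C.support.toFinset)
  have hB : ∀ C ∈ openCycles G ω' c, ∀ v ∈ C.support, v ∈ B := fun C hC v hv =>
    Finset.mem_insert_of_mem (Finset.mem_biUnion.mpr ⟨C, by simpa using hC, by simpa using hv⟩)
  obtain ⟨C, hC, u, hu, huT⟩ := exists_mem_openCycles_of_forall_joined (ω := ω') (c := c)
    (T := {y | Percolates G (ω \ B) y}) (fun y hy => hsub hy.mem.1) (hsub hc.mem)
    (fun h => h.mem.2 (Finset.mem_insert_self _ _)) (hω B).exists_percolates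
    (fun s hs t ht => hs.joined_setOf_percolates ((hω B).joined hs ht)) fun v hv => by
      obtain ⟨y, hy, hcy⟩ : ∃ y, Percolates G (ω \ {v}) y ∧ Joined G (ω' \ {v}) c y := by
        simpa [IsCutSite, hv] using hcut v
      obtain ⟨t, ht⟩ := (hω (insert v B)).exists_percolates
      have htv : Percolates G (ω \ {v}) t := ht.mono (Set.sdiff_subset_sdiff_right (by simp))
      have hyt : Joined G (ω \ {v}) y t := (hω.unique_sdiff_singleton v).joined hy htv
      exact ⟨t, ht.mono (Set.sdiff_subset_sdiff_right (by simp)),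
        hcy.trans (hyt.mono (Set.sdiff_subset_sdiff_left hsub))⟩
  exact huT.mem.2 (hB C hC u hu)

end OpenCycles

section FinitelyManyOpenCycles

open Measure unitInterval

variable {G : SimpleGraph V} {c : V}

theorem labelLaw_support_subset_openSites_le {C : G.Walk c c} (hC : C.IsCycle) (q : I) :
    labelLaw V {u | ∀ v ∈ C.support, v ∈ openSites q u} ≤ ENNReal.ofReal q ^ C.length := by
  classical
  have hcard : C.support.tail.toFinset.card = C.length := by
    rw [List.toFinset_card_of_nodup hC.support_nodup, List.length_tail, Walk.length_support,
      Nat.add_sub_cancel]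
  rw [← hcard, ← labelLaw_subset_openSites]
  exact measure_mono fun u hu v hv => hu v (List.mem_of_mem_tail (by simpa using hv))

theorem tsum_cycles_le [Fintype (G.neighborSet c)] (r : ℝ≥0∞) :
    ∑' C : {C : G.Walk c c // C.IsCycle}, r ^ C.1.length ≤
      ∑' n, G.degree c * (limitRadius G * r) ^ n := by
  rw [← ENNReal.tsum_fiberwise _ fun C : {C : G.Walk c c // C.IsCycle} => C.1.length]
  refine ENNReal.tsum_le_tsum fun n => ?_
  rw [ENNReal.tsum_eq_iSup_sum]
  refine iSup_le fun F => ?_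
  have hF : (F.card : ℝ≥0∞) ≤ G.degree c * limitRadius G ^ n := by
    rw [← F.card_map ((Embedding.subtype _).trans (Embedding.subtype _))]
    refine card_cycles_le_degree_mul_limitRadius_pow fun w hw => ?_
    obtain ⟨C, -, rfl⟩ := Finset.mem_map.mp hw
    exact ⟨C.1.2, C.2⟩
  calc ∑ C ∈ F, r ^ C.1.1.length = F.card * r ^ n := by
        rw [Finset.sum_congr rfl fun C _ => congrArg (r ^ ·) C.2, Finset.sum_const, nsmul_eq_mul]
    _ ≤ G.degree c * limitRadius G ^ n * r ^ n := by gcongr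
    _ = G.degree c * (limitRadius G * r) ^ n := by rw [mul_pow, mul_assoc]

theorem ae_forall_finite_openCycles [Countable V] [G.LocallyFinite] {q : I}
    (hq : limitRadius G * ENNReal.ofReal q < 1) :
    ∀ᵐ u ∂labelLaw V, ∀ c, (openCycles G (openSites q u) c).Finite := by
  refine ae_all_iff.mpr fun c => ?_
  have : Countable (G.Walk c c) := countable_walk c c
  have hsum : ∑' C : {C : G.Walk c c // C.IsCycle},
      labelLaw V {u | ∀ v ∈ C.1.support, v ∈ openSites q u} ≠ ∞ := by
    refine ne_top_of_le_ne_top ?_ ((ENNReal.tsum_le_tsum fun C =>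
      labelLaw_support_subset_openSites_le C.2 q).trans (tsum_cycles_le _))
    rw [ENNReal.tsum_mul_left, ENNReal.tsum_geometric]
    exact ENNReal.mul_ne_top (ENNReal.natCast_ne_top _)
      (ENNReal.inv_ne_top.mpr (tsub_pos_iff_lt.mpr hq).ne')
  filter_upwards [ae_finite_setOfPred_mem hsum] with u hu
  exact (hu.image Subtype.val).subset fun C hC => ⟨⟨C, hC.1⟩, hC.2, rfl⟩

end FinitelyManyOpenCycles

section Uniqueness

open unitInterval

variable {G : SimpleGraph V} [G.LocallyFinite]

theorem not_ae_hasUniqueInfiniteCluster [Countable V] {p q : I} (hpq : p < q)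
    (hq : limitRadius G * ENNReal.ofReal q < 1) :
    ¬∀ᵐ ω ∂ProbabilityTheory.setBernoulli (Set.univ : Set V) p, HasUniqueInfiniteCluster G ω := by
  intro hunique
  have hrobust : ∀ᵐ u ∂labelLaw V, RobustlyUnique G (openSites p u) :=
    ae_forall_openSites_sdiff (hpq.trans_le le_one') hunique
  obtain ⟨u, hu, hcut, hcycles⟩ := (hrobust.and
    ((ae_forall_finite_isCutSite hpq hrobust).and (ae_forall_finite_openCycles hq))).exists
  have hsub := openSites_mono hpq.le u
  obtain ⟨c, hc, hc'⟩ := exists_percolates_forall_not_isCutSite hsub hu hcut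
  exact infinite_openCycles hsub hu hc hc' (hcycles c)

theorem min_one_inv_limitRadius_le_uniquenessTransition [Countable V] :
    min 1 (limitRadius G)⁻¹ ≤ uniquenessTransition G := by
  refine le_iInf₂ fun p hp => ?_
  by_contra! hlt
  obtain ⟨q, hq0, hpq, hq⟩ := ENNReal.lt_iff_exists_real_btwn.mp hlt
  obtain ⟨hq1, hqρ⟩ := lt_min_iff.mp hq
  have hpq' : (p : ℝ) < q := (ENNReal.ofReal_lt_ofReal_iff_of_nonneg p.2.1).mp hpq
  exact not_ae_hasUniqueInfiniteCluster (q := ⟨q, hq0, (ENNReal.ofReal_lt_one.mp hq1).le⟩) hpq'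
    (ENNReal.mul_lt_of_lt_div' (by rwa [one_div])) hp

end Uniqueness

end SitePercolation

theorem theorem5_general {V ι : Type*} [Preorder ι] [IsDirectedOrder ι] [Nonempty ι] [Countable ι]
    (G : SimpleGraph V) [G.LocallyFinite] (S : ι → G.Subgraph) [∀ t, Finite (S t).verts]
    (hmono : Monotone S) (hlim : ⨆ t, S t = ⊤) :
    ∃ ρ₀ : ℝ≥0∞,
      Tendsto (fun t => SitePercolation.hashimotoRadius (S t).coe) atTop (𝓝 ρ₀) ∧
      (ρ₀ ≠ 0 → ρ₀⁻¹ ≤ SitePercolation.uniquenessTransition G) ∧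
      (ρ₀ = 0 → 1 ≤ SitePercolation.uniquenessTransition G) := by
  have hcover : ⋃ t, (S t).verts = Set.univ := by
    rw [← SimpleGraph.Subgraph.verts_iSup, hlim, SimpleGraph.Subgraph.verts_top]
  have : Countable V := Set.countable_univ_iff.mp
    (hcover ▸ Set.countable_iUnion fun t => (Set.toFinite _).countable)
  have hle := SitePercolation.min_one_inv_limitRadius_le_uniquenessTransition (G := G)
  refine ⟨SitePercolation.limitRadius G, SitePercolation.tendsto_hashimotoRadius hmono hlim,
    fun hne => ?_, fun h => ?_⟩
  · have hone : 1 ≤ SitePercolation.limitRadius G :=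
      (SitePercolation.limitRadius_eq_zero_or_one_le G).resolve_left hne
    rwa [min_eq_right (ENNReal.inv_le_one.mpr hone)] at hle
  · simpa [h] using hle

theorem theorem5 {V : Type*} (G : SimpleGraph V) [G.LocallyFinite] (hG : G.Connected)
    (S : ℕ → G.Subgraph) [∀ t, Finite (S t).verts] (hmono : Monotone S) (hlim : ⨆ t, S t = ⊤) :
    ∃ ρ₀ : ℝ≥0∞,
      Tendsto (fun t => SitePercolation.hashimotoRadius (S t).coe) atTop (𝓝 ρ₀) ∧
      (ρ₀ ≠ 0 → ρ₀⁻¹ ≤ SitePercolation.uniquenessTransition G) ∧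
      (ρ₀ = 0 → 1 ≤ SitePercolation.uniquenessTransition G) :=
  theorem5_general G S hmono hlim
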